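/- Let $K$ be a field of characteristic $0$ and let $X$ be a well-ordered set. Let $\mathrm{Magma}\langle X\rangle$ be the free nonassociative $K$-algebra on $X$ with product $\circ$, and let $\mathrm{Nov}\langle X\rangle$ be the free Novikov algebra on $X$, i.e. the quotient of $\mathrm{Magma}\langle X\rangle$ by the ideal generated by all values of the identities $(a\circ b)\circ c-a\circ(b\circ c)=(b\circ a)\circ c-b\circ(a\circ c)$ and $(a\circ b)\circ c=(a\circ c)\circ b$. Let $\mathrm{ComDer}\langle X\rangle=K[x^{(r)} : x\in X,\ r\ge 0]$ be the free differential commutative algebra on $X$, with $d(x^{(r)})=x^{(r+1)}$. Give monomials the additive weight with $\mathrm{wt}(x^{(r)})=r-1$, and let $\mathrm{ComDer}\langle X\rangle_{-1}$ be the span of the monomials of weight $-1$. Order the letters by $x^{(r)}>y^{(s)}$ if $r>s$, or $r=s$ and $x>y$. Each monomial of weight $-1$ has a unique normal form $$a=x_1x_2\cdots x_l\; y_n^{(r_n)}\cdots y_2^{(r_2)}y_1^{(r_1)},\qquad n\ge 0,\quad r_1,\dots,r_n\ge 1,\quad l=r_1+\dots+r_n-n+1,$$ with $x_i,y_j\in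 X$, $x_1\le\dots\le x_l$ and $y_n^{(r_n)}\ge\dots\ge y_1^{(r_1)}$; let $N(X)$ be the set of these normal forms. Define a linear map $\varphi:\mathrm{ComDer}\langle X\rangle_{-1}\to\mathrm{Magma}\langle X\rangle$ on $N(X)$ recursively by $\varphi(x_1)=x_1$ if $n=0$, and, for $n\ge1$, $$\varphi\big(x_1\cdots x_l\, y_n^{(r_n)}\cdots y_1^{(r_1)}\big)=\varphi\big(x_1\cdots x_{l-r_n}\,B\, y_{n-1}^{(r_{n-1})}\cdots y_1^{(r_1)}\big),\qquad B=x_l\circ(x_{l-1}\circ(\cdots\circ(x_{l+1-r_n}\circ y_n)\cdots)),$$ where $B$ is treated as a new letter of weight $-1$ that is larger than all previous letters. Put $N_\varphi=\{\varphi(a): a\in N(X)\}$. Then: (1) (the image of) $N_\varphi$ is a linear basis of $\mathrm{Nov}\langle X\rangle$. (2) $N_\varphi$ is the set of monomials attached to filled Young diagrams, as follows. Consider the Young diagrams with row lengths $\lambda_1>\lambda_2\ge\dots\ge\lambda_k\ge1$, $k\geq 1$, whose $s$-th row is filled with elements $z_{s,1},\dots,z_{s,\lambda_s-1},t_s$ of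 $X$ such that the sequence $z_{1,\lambda_1-1},\dots,z_{1,1},z_{2,\lambda_2-1},\dots,z_{2,1},\dots,z_{k,\lambda_k-1},\dots,z_{k,1}$ is weakly decreasing, $t_1\ge t_2$ if $\lambda_1=\lambda_2+1$, and $t_s\ge t_{s+1}$ if $s\ge2$ and $\lambda_s=\lambda_{s+1}$. To such a diagram attach $(\cdots((w_1\circ w_2)\circ w_3)\cdots)\circ w_k$, where $w_s=z_{s,\lambda_s-1}\circ(\cdots\circ(z_{s,2}\circ(z_{s,1}\circ t_s))\cdots)$. -/

import Mathlib

/-! ### The free Novikov algebra -/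

/-- The free magma algebra on `X` over `K`: the vector space spanned by all nonassociative words
in the alphabet `X`, with the bilinear product extending that of the free magma. -/
abbrev MagmaAlg (K X : Type*) [Field K] : Type _ := FreeNonUnitalNonAssocAlgebra K X

/-- A generator `x`, as an element of the free magma algebra. -/
noncomputable abbrev letter (K : Type*) {X : Type*} [Field K] (x : X) : MagmaAlg K X :=
  FreeNonUnitalNonAssocAlgebra.of K x

/-- A Novikov algebra: left symmetry and right commutativity. -/
class IsNovikov (A : Type*) [NonUnitalNonAssocRing A] : Prop where
  left_symm : ∀ a b c : A, (a * b) * c - a * (b * c) = (b * a) * c - b * (a * c)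
  right_comm : ∀ a b c : A, (a * b) * c = (a * c) * b

/-- `I` is a two-sided ideal containing all values of the two Novikov identities. -/
structure IsNovikovIdeal {K X : Type*} [Field K] (I : Submodule K (MagmaAlg K X)) : Prop where
  left_symm_mem : ∀ a b c : MagmaAlg K X,
    ((a * b) * c - a * (b * c)) - ((b * a) * c - b * (a * c)) ∈ I
  right_comm_mem : ∀ a b c : MagmaAlg K X, (a * b) * c - (a * c) * b ∈ I
  mul_left_mem : ∀ a b : MagmaAlg K X, b ∈ I → a * b ∈ I
  mul_right_mem : ∀ a b : MagmaAlg K X, a ∈ I → a * b ∈ I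

/-- The two-sided ideal of the free magma algebra generated by the Novikov identities. -/
noncomputable def novikovIdeal (K X : Type*) [Field K] : Submodule K (MagmaAlg K X) :=
  sInf {I | IsNovikovIdeal I}

theorem isNovikovIdeal_novikovIdeal (K X : Type*) [Field K] :
    IsNovikovIdeal (novikovIdeal K X) where
  left_symm_mem a b c := Submodule.mem_sInf.2 fun _ hI => hI.left_symm_mem a b c
  right_comm_mem a b c := Submodule.mem_sInf.2 fun _ hI => hI.right_comm_mem a b c
  mul_left_mem a b h := Submodule.mem_sInf.2 fun I hI =>
    hI.mul_left_mem a b (Submodule.mem_sInf.1 h I hI)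
  mul_right_mem a b h := Submodule.mem_sInf.2 fun I hI =>
    hI.mul_right_mem a b (Submodule.mem_sInf.1 h I hI)

/-- The free Novikov algebra on `X` over `K`. -/
abbrev FreeNovikov (K X : Type*) [Field K] : Type _ := MagmaAlg K X ⧸ novikovIdeal K X

namespace FreeNovikov

variable (K X : Type*) [Field K]

/-- The canonical projection of the free magma algebra onto the free Novikov algebra. -/
noncomputable def proj : MagmaAlg K X →ₗ[K] FreeNovikov K X := (novikovIdeal K X).mkQ

noncomputable instance : Mul (FreeNovikov K X) where
  mul := Quotient.map₂ (· * ·) (by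
    intro a a' ha b b' hb
    have ha := (Submodule.quotientRel_def _).1 ha
    have hb := (Submodule.quotientRel_def _).1 hb
    refine (Submodule.quotientRel_def _).2 ?_
    have h : a * b - a' * b' = (a - a') * b + a' * (b - b') := by
      rw [sub_mul, mul_sub]; abel
    rw [h]
    exact add_mem ((isNovikovIdeal_novikovIdeal K X).mul_right_mem _ _ ha)
      ((isNovikovIdeal_novikovIdeal K X).mul_left_mem _ _ hb))

theorem proj_mul (a b : MagmaAlg K X) : proj K X (a * b) = proj K X a * proj K X b := rfl

theorem proj_surjective : Function.Surjective (proj K X) := Submodule.mkQ_surjective _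

noncomputable instance : NonUnitalNonAssocRing (FreeNovikov K X) where
  left_distrib a b c := by
    obtain ⟨a, rfl⟩ := proj_surjective K X a
    obtain ⟨b, rfl⟩ := proj_surjective K X b
    obtain ⟨c, rfl⟩ := proj_surjective K X c
    simp only [← proj_mul, ← map_add, mul_add]
  right_distrib a b c := by
    obtain ⟨a, rfl⟩ := proj_surjective K X a
    obtain ⟨b, rfl⟩ := proj_surjective K X b
    obtain ⟨c, rfl⟩ := proj_surjective K X c
    simp only [← proj_mul, ← map_add, add_mul]
  zero_mul a := by
    obtain ⟨a, rfl⟩ := proj_surjective K X a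
    rw [← map_zero (proj K X), ← proj_mul, zero_mul]
  mul_zero a := by
    obtain ⟨a, rfl⟩ := proj_surjective K X a
    rw [← map_zero (proj K X), ← proj_mul, mul_zero]

instance : IsNovikov (FreeNovikov K X) where
  left_symm a b c := by
    obtain ⟨a, rfl⟩ := proj_surjective K X a
    obtain ⟨b, rfl⟩ := proj_surjective K X b
    obtain ⟨c, rfl⟩ := proj_surjective K X c
    simp only [← proj_mul, ← map_sub]
    exact (Submodule.Quotient.eq _).2 ((isNovikovIdeal_novikovIdeal K X).left_symm_mem a b c)
  right_comm a b c := by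
    obtain ⟨a, rfl⟩ := proj_surjective K X a
    obtain ⟨b, rfl⟩ := proj_surjective K X b
    obtain ⟨c, rfl⟩ := proj_surjective K X c
    simp only [← proj_mul]
    exact (Submodule.Quotient.eq _).2 ((isNovikovIdeal_novikovIdeal K X).right_comm_mem a b c)

end FreeNovikov

/-! ### Differential monomials of weight `-1` -/

/-- The underlying algebra of the free differential commutative algebra on `X`: polynomials in the
variables `(x, r)`, standing for `x^{(r)}`. -/
abbrev ComDer (K X : Type*) [Field K] : Type _ := MvPolynomial (X × ℕ) K

/-- The derivation of the free differential commutative algebra: `d (x^{(r)}) = x^{(r+1)}`. -/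
noncomputable def ComDer.d (K X : Type*) [Field K] : Derivation K (ComDer K X) (ComDer K X) :=
  MvPolynomial.mkDerivation K fun p : X × ℕ => MvPolynomial.X (p.1, p.2 + 1)

/-- The weight of a monomial, given by its exponent vector: it is additive under products and
`x^{(r)}` has weight `r - 1`. -/
def weight {X : Type*} (m : X × ℕ →₀ ℕ) : ℤ := m.sum fun p k => (k : ℤ) * ((p.2 : ℤ) - 1)

/-- The (exponent vectors of) monomials of weight `-1`. -/
def weightNegOne (X : Type*) : Set (X × ℕ →₀ ℕ) := {m | weight m = -1}

/-- The span of the monomials of weight `-1`. -/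
noncomputable abbrev ComDerNegOne (K X : Type*) [Field K] : Submodule K (ComDer K X) :=
  MvPolynomial.restrictSupport K (weightNegOne X)

/-! ### Normal forms and the map `φ` -/

/-- The underived letters `x_{i_1} ≤ … ≤ x_{i_l}` of a monomial, in increasing order. -/
noncomputable def plainLetters {X : Type*} [LinearOrder X] (m : X × ℕ →₀ ℕ) : List X :=
  (((Finsupp.toMultiset m).filter fun p => p.2 = 0).map Prod.fst).sort (· ≤ ·)

/-- The derived letters `x^{(r)}`, `r ≥ 1`, of a monomial, each as the pair `(r, x)`, in decreasing
order with respect to `r` first and `x` second. In particular the letters `x'` come last. -/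
noncomputable def derivedLetters {X : Type*} [LinearOrder X] (m : X × ℕ →₀ ℕ) :
    List (ℕ ×ₗ X) :=
  (((Finsupp.toMultiset m).filter fun p => 1 ≤ p.2).map fun p => toLex (p.2, p.1)).sort (· ≥ ·)

section Words

variable {K X : Type*} [Field K]

/-- `nest [b₁, …, bₛ] c = bₛ ∘ (bₛ₋₁ ∘ (… ∘ (b₁ ∘ c) …))`. -/
noncomputable def nest (bs : List (MagmaAlg K X)) (c : MagmaAlg K X) : MagmaAlg K X :=
  bs.foldl (fun w b => b * w) c

/-- The value of `φ` on the word `b₁ … b_l y_n^{(r_n)} … y_1^{(r_1)}`, where the `b_i` are letters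
of the current (extended) alphabet in increasing order, and the derived letters are in decreasing
order. The last `r_n` letters `b_i` are merged with `y_n^{(r_n)}` into a new letter, which becomes
the largest one. For a word of weight `-1` exactly one letter remains at the end. -/
noncomputable def phiWord : List (MagmaAlg K X) → List (ℕ ×ₗ X) → MagmaAlg K X
  | bs, [] => bs.headD 0
  | bs, y :: ys =>
    let r := (ofLex y).1
    let k := bs.length - r
    phiWord (bs.take k ++ [nest (bs.drop k) (letter K (ofLex y).2)]) ys

end Words

/-- The linear map `φ` from the span of the monomials of weight `-1` to the free magma algebra. -/
noncomputable def phi (K X : Type*) [Field K] [LinearOrder X] :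
    ComDerNegOne K X →ₗ[K] MagmaAlg K X :=
  (MvPolynomial.basisRestrictSupport K (weightNegOne X)).constr K fun m =>
    phiWord ((plainLetters m.1).map (letter K)) (derivedLetters m.1)

/-- The set `N_φ` of all `φ(a)`, where `a` runs over the monomials of weight `-1`. -/
def Nphi (K X : Type*) [Field K] [LinearOrder X] : Set (MagmaAlg K X) :=
  {w | ∃ a : ComDerNegOne K X,
    (∃ m ∈ weightNegOne X, (a : ComDer K X) = MvPolynomial.monomial m 1) ∧ phi K X a = w}

/-! ### Filled Young diagrams -/

/-- A nonempty row of a filled diagram: the entries before the last one, from left to right, and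
the last entry. -/
structure FilledRow (X : Type*) where
  init : List X
  last : X

/-- The number of boxes of a row. -/
def FilledRow.len {X : Type*} (ρ : FilledRow X) : ℕ := ρ.init.length + 1

/-- A Young diagram with rows of lengths `λ₁ > λ₂ ≥ … ≥ λ_k ≥ 1`, filled with elements of `X`.
The entries that are not last in their row weakly decrease when each row is read from right to left
and the rows from top to bottom; the last entries `t_s` satisfy `t₁ ≥ t₂` if `λ₁ = λ₂ + 1` and
`t_s ≥ t_{s+1}` if `s ≥ 2` and `λ_s = λ_{s+1}`. -/
structure FilledYoung (X : Type*) [LinearOrder X] where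
  first : FilledRow X
  rest : List (FilledRow X)
  first_longer : ∀ ρ ∈ rest, ρ.len < first.len
  rest_len : rest.Pairwise fun ρ σ => σ.len ≤ ρ.len
  inits : ((first :: rest).flatMap fun ρ => ρ.init.reverse).Pairwise (· ≥ ·)
  first_last : ∀ ρ ∈ rest.head?, first.len = ρ.len + 1 → first.last ≥ ρ.last
  rest_last : rest.IsChain fun ρ σ => ρ.len = σ.len → ρ.last ≥ σ.last

/-- The monomial `x_{λ-1} ∘ (… ∘ (x_2 ∘ (x_1 ∘ t)) …)` of a row `x_1, …, x_{λ-1}, t`. -/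
noncomputable def FilledRow.monomial (K : Type*) {X : Type*} [Field K] (ρ : FilledRow X) :
    MagmaAlg K X :=
  nest (ρ.init.map (letter K)) (letter K ρ.last)

/-- The monomial `(… ((w₁ ∘ w₂) ∘ w₃) …) ∘ w_k` of a filled diagram with row monomials `w_s`. -/
noncomputable def FilledYoung.monomial (K : Type*) {X : Type*} [Field K] [LinearOrder X]
    (T : FilledYoung X) : MagmaAlg K X :=
  T.rest.foldl (fun u ρ => u * ρ.monomial K) (T.first.monomial K)

/-! ### The commutative algebra of right multiplications of a Novikov algebra -/

section NovikovAlgebra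

open scoped IsMulCommutative

set_option linter.unusedSectionVars false

variable (K : Type*) {A : Type*} [Field K] [NonUnitalNonAssocRing A] [Module K A]
  [IsScalarTower K A A] [SMulCommClass K A A]

variable (A) in
/-- The algebra of operators on `A` generated by the right multiplications. -/
def rightMulAlg : Subalgebra K (Module.End K A) :=
  Algebra.adjoin K (Set.range fun b : A => LinearMap.mulRight K b)

/-- The right multiplication by `b`, as an element of `rightMulAlg`. -/
def rmul (b : A) : rightMulAlg K A :=
  ⟨LinearMap.mulRight K b, Algebra.subset_adjoin ⟨b, rfl⟩⟩

@[simp]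
theorem rmul_smul (b a : A) : rmul K b • a = a * b := rfl

variable {K}

theorem rightMulAlg_ext {ρ σ : rightMulAlg K A} (h : ∀ a : A, ρ • a = σ • a) : ρ = σ :=
  Subtype.ext (LinearMap.ext h)

theorem rightMulAlg_induction {p : rightMulAlg K A → Prop} (hr : ∀ b : A, p (rmul K b))
    (hc : ∀ c : K, p (algebraMap K _ c)) (hadd : ∀ ρ σ, p ρ → p σ → p (ρ + σ))
    (hmul : ∀ ρ σ, p ρ → p σ → p (ρ * σ)) (ρ : rightMulAlg K A) : p ρ := by
  obtain ⟨f, hf⟩ := ρ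
  refine Algebra.adjoin_induction (p := fun f hf => p ⟨f, hf⟩) ?_ ?_ ?_ ?_ hf
  · rintro _ ⟨b, rfl⟩
    exact hr b
  · exact hc
  · exact fun x y hx hy => hadd ⟨x, hx⟩ ⟨y, hy⟩
  · exact fun x y hx hy => hmul ⟨x, hx⟩ ⟨y, hy⟩

variable [IsNovikov A]

instance : IsMulCommutative (rightMulAlg K A) :=
  Algebra.isMulCommutative_adjoin K (by
    rintro _ ⟨b, rfl⟩ _ ⟨c, rfl⟩
    ext a
    exact IsNovikov.right_comm a c b)

theorem mul_rmul_sub (z a b : A) : z * (a * b) - (z * a) * b = a * (z * b) - (a * z) * b := by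
  rw [← neg_sub, IsNovikov.left_symm, neg_sub]

theorem commutator_mem (z : A) (ρ : rightMulAlg K A) :
    LinearMap.mulLeft K z * (ρ : Module.End K A) - ρ * LinearMap.mulLeft K z
      ∈ rightMulAlg K A := by
  induction ρ using rightMulAlg_induction with
  | hr b =>
    convert (rmul K (z * b) - rmul K b * rmul K z).2 using 1
    ext a
    exact mul_rmul_sub z a b
  | hc c =>
    convert (rightMulAlg K A).zero_mem using 1
    ext a
    simp
  | hadd ρ σ hρ hσ =>
    convert add_mem hρ hσ using 1
    push_cast
    noncomm_ring
  | hmul ρ σ hρ hσ =>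
    convert add_mem (mul_mem hρ σ.2) (mul_mem ρ.2 hσ) using 1
    push_cast
    noncomm_ring

/-- The commutator of the left multiplication by `z` with an operator in `rightMulAlg`. -/
def commLin (z : A) : rightMulAlg K A →ₗ[K] rightMulAlg K A where
  toFun ρ := ⟨_, commutator_mem z ρ⟩
  map_add' ρ σ := Subtype.ext <| by push_cast; noncomm_ring
  map_smul' c ρ := Subtype.ext <| by ext a; simp [smul_sub]

theorem commLin_smul (z : A) (ρ : rightMulAlg K A) (a : A) :
    commLin z ρ • a = z * (ρ • a) - ρ • (z * a) := rfl

variable (K) in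
/-- The derivation `ρ ↦ [L_z, ρ]` of the algebra of right multiplications. -/
def commDer (z : A) : Derivation K (rightMulAlg K A) (rightMulAlg K A) :=
  Derivation.mk' (commLin z) fun ρ σ => rightMulAlg_ext fun a => by
    rw [smul_eq_mul, smul_eq_mul, mul_comm σ, add_smul, mul_smul, mul_smul]
    simp only [commLin_smul, mul_smul, smul_sub]
    abel

theorem commDer_smul (z : A) (ρ : rightMulAlg K A) (a : A) :
    commDer K z ρ • a = z * (ρ • a) - ρ • (z * a) := rfl

theorem commDer_smul_comm (a b : A) (ρ : rightMulAlg K A) :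
    commDer K a ρ • b = commDer K b ρ • a := by
  induction ρ using rightMulAlg_induction with
  | hr c => exact mul_rmul_sub a b c
  | hc c => simp only [Derivation.map_algebraMap, zero_smul]
  | hadd ρ σ hρ hσ => simp only [map_add, add_smul, hρ, hσ]
  | hmul ρ σ hρ hσ =>
    simp only [Derivation.leibniz, add_smul, hρ, hσ, smul_eq_mul, mul_smul]

theorem rmul_smul_eq (ρ : rightMulAlg K A) (a : A) :
    rmul K (ρ • a) = ρ * rmul K a + commDer K a ρ := rightMulAlg_ext fun b => by
  rw [add_smul, mul_smul, commDer_smul_comm, commDer_smul, rmul_smul, rmul_smul]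
  abel

/-! ### Legs -/

open Classical in
variable (K) in
/-- Auxiliary definition for `leg`, by recursion on the cardinality of the multiset. -/
noncomputable def legAux (t : A) : ℕ → Multiset A → rightMulAlg K A
  | 0, _ => rmul K t
  | n + 1, M =>
    rmul K (if h : ∃ z, z ∈ M then legAux t n (M.erase h.choose) • h.choose else 0) -
      (M.map fun y => rmul K y * legAux t n (M.erase y)).sum

open Classical in
theorem legAux_cons_of_symm {t : A} {n : ℕ} {M : Multiset A} {z : A}
    (h : ∀ w ∈ z ::ₘ M,
      legAux K t n ((z ::ₘ M).erase w) • w = legAux K t n M • z) :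
    legAux K t (n + 1) (z ::ₘ M) = commDer K z (legAux K t n M) -
      (M.map fun y => rmul K y * legAux K t n ((z ::ₘ M).erase y)).sum := by
  have hex : ∃ w, w ∈ z ::ₘ M := ⟨z, Multiset.mem_cons_self z M⟩
  rw [legAux, dif_pos hex, h _ hex.choose_spec, rmul_smul_eq, Multiset.map_cons,
    Multiset.sum_cons, Multiset.erase_cons_head]
  ring

open Classical in
theorem legAux_cons_and_symm (t : A) (n : ℕ) :
    (∀ (M : Multiset A) (z : A), M.card = n →
      legAux K t (n + 1) (z ::ₘ M) = commDer K z (legAux K t n M) -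
        (M.map fun y => rmul K y * legAux K t n ((z ::ₘ M).erase y)).sum) ∧
    ∀ (M : Multiset A) (z w : A), M.card = n →
      legAux K t (n + 1) (z ::ₘ M) • w = legAux K t (n + 1) (w ::ₘ M) • z := by
  induction n with
  | zero =>
    have h : ∀ (M : Multiset A) (z : A), M.card = 0 →
      legAux K t (0 + 1) (z ::ₘ M) = commDer K z (legAux K t 0 M) -
        (M.map fun y => rmul K y * legAux K t 0 ((z ::ₘ M).erase y)).sum := by
      intro M z hM
      refine legAux_cons_of_symm fun w hw => ?_
      obtain rfl := Multiset.card_eq_zero.1 hM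
      obtain rfl : w = z := by simpa using hw
      simp
    refine ⟨h, fun M z w hM => ?_⟩
    rw [h M z hM, h M w hM]
    obtain rfl := Multiset.card_eq_zero.1 hM
    simpa using commDer_smul_comm z w _
  | succ n ih =>
    have h : ∀ (M : Multiset A) (z : A), M.card = n + 1 →
      legAux K t (n + 1 + 1) (z ::ₘ M) = commDer K z (legAux K t (n + 1) M) -
        (M.map fun y => rmul K y * legAux K t (n + 1) ((z ::ₘ M).erase y)).sum := by
      intro M z hM
      refine legAux_cons_of_symm fun w hw => ?_
      rcases Multiset.mem_cons.1 hw with rfl | hw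
      · rw [Multiset.erase_cons_head]
      · obtain ⟨M', rfl⟩ := Multiset.exists_cons_of_mem hw
        rw [Multiset.erase_cons_tail_of_mem hw, Multiset.erase_cons_head]
        exact ih.2 M' z w (by simpa using hM)
    refine ⟨h, fun M z w hM => ?_⟩
    rw [h M z hM, h M w hM, sub_smul, sub_smul, commDer_smul_comm z w, Multiset.sum_smul,
      Multiset.sum_smul, Multiset.map_map, Multiset.map_map]
    congr 2
    refine Multiset.map_congr rfl fun y hy => ?_
    simp only [Function.comp_apply]
    rw [mul_smul, mul_smul, Multiset.erase_cons_tail_of_mem hy,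
      Multiset.erase_cons_tail_of_mem hy, ih.2 _ z w]
    rw [Multiset.card_erase_of_mem hy, hM, Nat.pred_succ]

variable (K) in
/-- The operator on a Novikov algebra corresponding to the multiplication by
`z₁ ⋯ zₙ t^{(n + 1)}` in a differential commutative algebra, where `M = {z₁, …, zₙ}`. -/
noncomputable def leg (t : A) (M : Multiset A) : rightMulAlg K A := legAux K t M.card M

@[simp]
theorem leg_zero (t : A) : leg K t 0 = rmul K t := rfl

open Classical in
theorem leg_cons (t z : A) (M : Multiset A) :
    leg K t (z ::ₘ M) = commDer K z (leg K t M) -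
      (M.map fun y => rmul K y * leg K t ((z ::ₘ M).erase y)).sum := by
  rw [leg, Multiset.card_cons, (legAux_cons_and_symm t _).1 M z rfl, leg]
  congr 2
  refine Multiset.map_congr rfl fun y hy => ?_
  rw [leg, Multiset.card_erase_of_mem (Multiset.mem_cons_of_mem hy), Multiset.card_cons,
    Nat.pred_succ]

open Classical in
theorem leg_cons_smul (t z : A) (M : Multiset A) (a : A) :
    leg K t (z ::ₘ M) • a = z * (leg K t M • a) - leg K t M • (z * a) -
      (M.map fun y => (leg K t ((z ::ₘ M).erase y) • a) * y).sum := by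
  rw [leg_cons, sub_smul, commDer_smul, Multiset.sum_smul, Multiset.map_map]
  rfl

theorem leg_cons_smul_comm (t z w : A) (M : Multiset A) :
    leg K t (z ::ₘ M) • w = leg K t (w ::ₘ M) • z := by
  rw [leg, leg, Multiset.card_cons, Multiset.card_cons]
  exact (legAux_cons_and_symm t _).2 M z w rfl

/-! ### Elements attached to monomials -/

variable (K) in
/-- The element of a Novikov algebra corresponding to the monomial
`b₁ ⋯ b_l y₁^{(r₁)} ⋯ yₙ^{(rₙ)}` of weight `-1` of a differential commutative algebra. -/
noncomputable def spider : List A → List (ℕ × A) → A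
  | [], _ => 0
  | [b], [] => b
  | _ :: _ :: _, [] => 0
  | b :: bs, y :: ys =>
    leg K y.2 (bs.take (y.1 - 1) : Multiset A) • spider (b :: bs.drop (y.1 - 1)) ys

theorem smul_smul_comm (ρ σ : rightMulAlg K A) (a : A) : ρ • σ • a = σ • ρ • a := by
  rw [smul_smul, mul_comm, mul_smul]

theorem spider_smul (ρ : rightMulAlg K A) (b : A) (bs : List A) (ys : List (ℕ × A)) :
    spider K ((ρ • b) :: bs) ys = ρ • spider K (b :: bs) ys := by
  induction ys generalizing bs with
  | nil =>
    cases bs with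
    | nil => rfl
    | cons c bs => exact (smul_zero ρ).symm
  | cons y ys ih => rw [spider, spider, ih, smul_smul_comm]

theorem leg_take_smul_perm {H : List A → A}
    (hsmul : ∀ (ρ : rightMulAlg K A) b bs, H ((ρ • b) :: bs) = ρ • H (b :: bs))
    (hperm : ∀ bs cs : List A, bs.Perm cs → H bs = H cs) (t b : A) {bs cs : List A}
    (h : bs.Perm cs) (M : Multiset A) (k : ℕ) :
    leg K t (M + (bs.take k : Multiset A)) • H (b :: bs.drop k) =
      leg K t (M + (cs.take k : Multiset A)) • H (b :: cs.drop k) := by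
  induction h generalizing M k with
  | nil => rfl
  | @cons c bs cs h ih =>
    cases k with
    | zero =>
      simp only [List.take_zero, List.drop_zero]
      rw [hperm _ _ ((h.cons c).cons b)]
    | succ k =>
      simp only [List.take_succ_cons, List.drop_succ_cons, ← Multiset.cons_coe, Multiset.add_cons,
        ← Multiset.cons_add]
      exact ih _ _
  | swap c d bs =>
    rcases k with _ | _ | k
    · simp only [List.take_zero, List.drop_zero]
      rw [hperm _ _ ((List.Perm.swap c d bs).cons b)]
    · simp only [List.take_succ_cons, List.drop_succ_cons, ← Multiset.cons_coe, Multiset.add_cons,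
        List.take_zero, List.drop_zero, Multiset.coe_nil, add_zero]
      rw [hperm _ _ (List.Perm.swap c b bs), hperm _ _ (List.Perm.swap d b bs), ← hsmul,
        leg_cons_smul_comm, hsmul]
    · simp only [List.take_succ_cons, List.drop_succ_cons, ← Multiset.cons_coe]
      rw [Multiset.cons_swap]
  | trans _ _ ih₁ ih₂ => exact (ih₁ M k).trans (ih₂ M k)

theorem spider_perm {bs cs : List A} (h : bs.Perm cs) (ys : List (ℕ × A)) :
    spider K bs ys = spider K cs ys := by
  induction ys generalizing bs cs with
  | nil =>
    match bs, cs, h.length_eq with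
    | [], [], _ => rfl
    | [b], [c], _ => rw [List.perm_singleton.1 h]
    | _ :: _ :: _, _ :: _ :: _, _ => rfl
  | cons y ys ih =>
    have hperm : ∀ bs cs : List A, bs.Perm cs → spider K bs ys = spider K cs ys :=
      fun _ _ h => ih h
    have hsmul := fun (ρ : rightMulAlg K A) b bs => spider_smul ρ b bs ys
    induction h with
    | nil => rfl
    | cons b h _ =>
      have := leg_take_smul_perm hsmul hperm y.2 b h 0 (y.1 - 1)
      rw [spider, spider]
      simpa only [zero_add] using this
    | swap b c bs =>
      rw [spider, spider]
      rcases y.1 - 1 with _ | k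
      · simp only [List.take_zero, List.drop_zero]
        rw [hperm _ _ (List.Perm.swap b c bs)]
      · simp only [List.take_succ_cons, List.drop_succ_cons, ← Multiset.cons_coe]
        rw [← hsmul, leg_cons_smul_comm, hsmul]
    | trans _ _ h₁ h₂ => exact h₁.trans h₂

variable {X : Type*} (f : X → A)

variable (K) in
/-- The algebra of operators generated by the legs labelled by the values of `f`. -/
noncomputable def legAlg : Subalgebra K (rightMulAlg K A) :=
  Algebra.adjoin K (Set.range fun p : X × Multiset X => leg K (f p.1) (p.2.map f))

theorem leg_mem (t : X) (M : Multiset X) : leg K (f t) (M.map f) ∈ legAlg K f :=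
  Algebra.subset_adjoin ⟨(t, M), rfl⟩

theorem rmul_letter_mem (x : X) : rmul K (f x) ∈ legAlg K f := leg_mem f x 0

theorem commDer_mem {x : X} {ρ : rightMulAlg K A} (hρ : ρ ∈ legAlg K f) :
    commDer K (f x) ρ ∈ legAlg K f := by
  classical
  induction hρ using Algebra.adjoin_induction with
  | mem _ h =>
    obtain ⟨⟨t, M⟩, rfl⟩ := h
    have h := leg_cons (K := K) (f t) (f x) (M.map f)
    rw [eq_sub_iff_add_eq] at h
    rw [← h, ← Multiset.map_cons]
    refine add_mem (leg_mem f t _) (multiset_sum_mem _ fun c hc => ?_)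
    simp only [Multiset.mem_map, exists_exists_and_eq_and] at hc
    obtain ⟨y, hy, rfl⟩ := hc
    refine mul_mem (rmul_letter_mem f y) ?_
    obtain ⟨N, hN⟩ := Multiset.exists_cons_of_mem (Multiset.mem_cons_of_mem (a := y) (b := x) hy)
    rw [hN, Multiset.map_cons, Multiset.erase_cons_head]
    exact leg_mem f t N
  | algebraMap c =>
    rw [Derivation.map_algebraMap]
    exact zero_mem _
  | add ρ σ _ _ hρ hσ =>
    rw [map_add]
    exact add_mem hρ hσ
  | mul ρ σ h₁ h₂ hρ hσ =>
    rw [Derivation.leibniz]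
    exact add_mem (mul_mem h₁ hσ) (mul_mem h₂ hρ)

theorem rmul_add (a b : A) : rmul K (a + b) = rmul K a + rmul K b :=
  rightMulAlg_ext fun c => mul_add c a b

theorem rmul_smul' (r : K) (a : A) : rmul K (r • a) = r • rmul K a :=
  rightMulAlg_ext fun c => mul_smul_comm r c a

variable (K) in
/-- The submodule generated by the values of `f` over the algebra `legAlg`. -/
def legSpan : Submodule K A :=
  Submodule.span K {a | ∃ ρ ∈ legAlg K f, ∃ x, ρ • f x = a}

theorem rmul_mem_of_mem_legSpan {a : A} (ha : a ∈ legSpan K f) : rmul K a ∈ legAlg K f := by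
  induction ha using Submodule.span_induction with
  | mem _ h =>
    obtain ⟨ρ, hρ, x, rfl⟩ := h
    rw [rmul_smul_eq]
    exact add_mem (mul_mem hρ (rmul_letter_mem f x)) (commDer_mem f hρ)
  | zero =>
    convert zero_mem (legAlg K f)
    exact rightMulAlg_ext fun c => mul_zero c
  | add a b _ _ ha hb =>
    rw [rmul_add]
    exact add_mem ha hb
  | smul r a _ ha =>
    rw [rmul_smul']
    exact Subalgebra.smul_mem _ ha r

theorem mul_mem_legSpan {a b : A} (ha : a ∈ legSpan K f) (hb : b ∈ legSpan K f) :
    a * b ∈ legSpan K f := by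
  induction ha using Submodule.span_induction with
  | mem _ h =>
    obtain ⟨ρ, hρ, x, rfl⟩ := h
    refine Submodule.subset_span ⟨rmul K b * ρ, mul_mem (rmul_mem_of_mem_legSpan f hb) hρ, x, ?_⟩
    rw [mul_smul, rmul_smul]
  | zero =>
    rw [zero_mul]
    exact zero_mem _
  | add a c _ _ ha hc =>
    rw [add_mul]
    exact add_mem ha hc
  | smul r a _ ha =>
    rw [smul_mul_assoc]
    exact Submodule.smul_mem _ r ha

theorem letter_mem_legSpan (x : X) : f x ∈ legSpan K f :=
  Submodule.subset_span ⟨1, one_mem _, x, one_smul _ _⟩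

theorem legSpan_le :
    legSpan K f ≤ Submodule.span K (Set.range fun p : X × List (X × Multiset X) =>
      (p.2.map fun q => leg K (f q.1) (q.2.map f)).prod • f p.1) := by
  refine Submodule.span_le.2 ?_
  rintro _ ⟨ρ, hρ, x, rfl⟩
  rw [legAlg, ← Subalgebra.mem_toSubmodule, Algebra.adjoin_eq_span] at hρ
  induction hρ using Submodule.span_induction with
  | mem ρ h =>
    obtain ⟨l, hl, rfl⟩ := Submonoid.exists_list_of_mem_closure h
    have : Nonempty (X × Multiset X) := ⟨(x, 0)⟩
    choose! g hg using hl
    refine Submodule.subset_span ⟨(x, l.map g), ?_⟩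
    simp only [List.map_map]
    congr 2
    conv_rhs => rw [← List.map_id l]
    exact List.map_congr_left fun y hy => hg y hy
  | zero =>
    rw [zero_smul]
    exact zero_mem _
  | add a c _ _ ha hc =>
    rw [add_smul]
    exact add_mem ha hc
  | smul r a _ ha =>
    rw [smul_assoc]
    exact Submodule.smul_mem _ r ha

theorem prod_leg_smul (b : A) (L : List (X × Multiset X)) :
    (L.map fun q => leg K (f q.1) (q.2.map f)).prod • b =
      spider K (b :: L.flatMap fun q => q.2.toList.map f)
        (L.map fun q => (q.2.card + 1, f q.1)) := by
  induction L with
  | nil => simp [spider]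
  | cons q L ih =>
    rw [List.map_cons, List.prod_cons, mul_smul, ih, List.flatMap_cons, List.map_cons, spider,
      Nat.add_sub_cancel, List.take_left', List.drop_left']
    · rw [← Multiset.map_coe, Multiset.coe_toList]
    all_goals simp

end NovikovAlgebra

/-! ### The evaluation of the free Novikov algebra in the free differential algebra -/

section Evaluation

variable (K X : Type*) [Field K]

instance : IsScalarTower K (FreeNovikov K X) (FreeNovikov K X) where
  smul_assoc r a b := by
    obtain ⟨a, rfl⟩ := FreeNovikov.proj_surjective K X a
    obtain ⟨b, rfl⟩ := FreeNovikov.proj_surjective K X b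
    simp only [smul_eq_mul, ← map_smul, ← FreeNovikov.proj_mul, smul_mul_assoc]

instance : SMulCommClass K (FreeNovikov K X) (FreeNovikov K X) where
  smul_comm r a b := by
    obtain ⟨a, rfl⟩ := FreeNovikov.proj_surjective K X a
    obtain ⟨b, rfl⟩ := FreeNovikov.proj_surjective K X b
    simp only [smul_eq_mul, ← map_smul, ← FreeNovikov.proj_mul, mul_smul_comm]

/-- The free differential commutative algebra, with the Novikov product `a ∘ b = a * d b`. -/
def ComDerNovikov : Type _ := ComDer K X

namespace ComDerNovikov

noncomputable instance : AddCommGroup (ComDerNovikov K X) :=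
  inferInstanceAs (AddCommGroup (ComDer K X))

noncomputable instance : Module K (ComDerNovikov K X) :=
  inferInstanceAs (Module K (ComDer K X))

noncomputable instance : Mul (ComDerNovikov K X) where
  mul a b := (show ComDer K X from a) * ComDer.d K X b

theorem mul_def (a b : ComDerNovikov K X) :
    a * b = (show ComDer K X from a) * ComDer.d K X b := rfl

noncomputable instance : NonUnitalNonAssocRing (ComDerNovikov K X) where
  left_distrib a b c := by
    simp only [mul_def]
    erw [map_add, mul_add]
    rfl
  right_distrib a b c := add_mul (R := ComDer K X) _ _ _
  zero_mul a := zero_mul (M₀ := ComDer K X) _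
  mul_zero a := by
    simp only [mul_def]
    erw [map_zero, mul_zero]
    rfl

instance : IsScalarTower K (ComDerNovikov K X) (ComDerNovikov K X) where
  smul_assoc r a b := smul_mul_assoc (β := ComDer K X) r _ _

instance : SMulCommClass K (ComDerNovikov K X) (ComDerNovikov K X) where
  smul_comm r a b := by
    simp only [smul_eq_mul, mul_def]
    erw [Derivation.map_smul, mul_smul_comm]
    rfl

theorem left_symm (a b c : ComDer K X) :
    a * ComDer.d K X b * ComDer.d K X c - a * ComDer.d K X (b * ComDer.d K X c) =
      b * ComDer.d K X a * ComDer.d K X c - b * ComDer.d K X (a * ComDer.d K X c) := by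
  simp only [Derivation.leibniz, smul_eq_mul]
  ring

instance : IsNovikov (ComDerNovikov K X) where
  left_symm := left_symm K X
  right_comm _ _ _ := mul_right_comm (G := ComDer K X) _ _ _

variable {X} in
/-- A generator, as an element of `ComDerNovikov`. -/
noncomputable def letter (x : X) : ComDerNovikov K X := (MvPolynomial.X (x, 0) : ComDer K X)

end ComDerNovikov

/-- The evaluation of nonassociative polynomials in the free differential commutative algebra. -/
noncomputable def evalMagma : MagmaAlg K X →ₙₐ[K] ComDerNovikov K X :=
  FreeNonUnitalNonAssocAlgebra.lift K (ComDerNovikov.letter K)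

theorem isNovikovIdeal_ker_evalMagma :
    IsNovikovIdeal (LinearMap.ker (evalMagma K X : MagmaAlg K X →ₗ[K] ComDerNovikov K X)) where
  left_symm_mem a b c := by
    simpa [sub_eq_zero] using IsNovikov.left_symm (evalMagma K X a) (evalMagma K X b) _
  right_comm_mem a b c := by
    simpa [sub_eq_zero] using IsNovikov.right_comm (evalMagma K X a) (evalMagma K X b) _
  mul_left_mem _ b h := by
    have h : evalMagma K X b = 0 := h
    simp [h]
  mul_right_mem a _ h := by
    have h : evalMagma K X a = 0 := h
    simp [h]

/-- The evaluation of the free Novikov algebra in the free differential commutative algebra. -/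
noncomputable def evalNovikov : FreeNovikov K X →ₗ[K] ComDer K X :=
  (novikovIdeal K X).liftQ (evalMagma K X : MagmaAlg K X →ₗ[K] ComDerNovikov K X)
    (sInf_le (isNovikovIdeal_ker_evalMagma K X))

variable {X}

/-- A generator of the free Novikov algebra. -/
noncomputable def novLetter (x : X) : FreeNovikov K X := FreeNovikov.proj K X (letter K x)

variable (X)
variable {K}

theorem evalNovikov_novLetter (x : X) :
    evalNovikov K X (novLetter K x) = MvPolynomial.X (x, 0) := by
  change evalMagma K X (letter K x) = _
  rw [evalMagma, _root_.letter, FreeNonUnitalNonAssocAlgebra.lift_of_apply]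
  rfl

theorem evalNovikov_mul (a b : FreeNovikov K X) :
    evalNovikov K X (a * b) = evalNovikov K X a * ComDer.d K X (evalNovikov K X b) := by
  obtain ⟨a, rfl⟩ := FreeNovikov.proj_surjective K X a
  obtain ⟨b, rfl⟩ := FreeNovikov.proj_surjective K X b
  exact map_mul (evalMagma K X) a b

variable {X}

theorem FreeNovikov.eq_top_of_mul_mem {V : Submodule K (FreeNovikov K X)}
    (hV : ∀ x, novLetter K x ∈ V) (hmul : ∀ a ∈ V, ∀ b ∈ V, a * b ∈ V) : V = ⊤ := by
  let W : NonUnitalSubalgebra K (MagmaAlg K X) :=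
    { V.comap (FreeNovikov.proj K X) with
      mul_mem' := fun {a b} ha hb => hmul _ ha _ hb }
  let g : MagmaAlg K X →ₙₐ[K] W :=
    FreeNonUnitalNonAssocAlgebra.lift K fun x => ⟨letter K x, hV x⟩
  have hg : (NonUnitalSubalgebraClass.subtype W).comp g = NonUnitalAlgHom.id K (MagmaAlg K X) := by
    refine FreeNonUnitalNonAssocAlgebra.hom_ext K (fun x => ?_)
    simp [g, letter]
  refine Submodule.eq_top_iff'.2 fun a => ?_
  obtain ⟨a, rfl⟩ := FreeNovikov.proj_surjective K X a
  have : ((g a : W) : MagmaAlg K X) = a := DFunLike.congr_fun hg a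
  rw [← this]
  exact (g a).2

theorem Derivation.leibniz_multiset_prod {R ι : Type*} {S : Type*} [CommRing R] [CommRing S]
    [Algebra R S] [DecidableEq ι] (D : Derivation R S S) (f : ι → S) (M : Multiset ι) :
    D (M.map f).prod = (M.map fun y => ((M.erase y).map f).prod * D (f y)).sum := by
  induction M using Multiset.induction with
  | empty => simp
  | cons c M ih =>
    rw [Multiset.map_cons, Multiset.prod_cons, D.leibniz, ih, Multiset.map_cons,
      Multiset.sum_cons, Multiset.erase_cons_head, add_comm, smul_eq_mul, smul_eq_mul,
      ← Multiset.sum_map_mul_left]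
    congr 2
    refine Multiset.map_congr rfl fun y hy => ?_
    rw [Multiset.erase_cons_tail_of_mem hy, Multiset.map_cons, Multiset.prod_cons, mul_assoc]

theorem evalNovikov_leg_smul (t : FreeNovikov K X) (M : Multiset (FreeNovikov K X))
    (a : FreeNovikov K X) :
    evalNovikov K X (leg K t M • a) = evalNovikov K X a * ((M.map (evalNovikov K X)).prod *
      (ComDer.d K X)^[M.card + 1] (evalNovikov K X t)) := by
  classical
  induction h : M.card generalizing M a with
  | zero =>
    obtain rfl := Multiset.card_eq_zero.1 h
    simp [evalNovikov_mul]
  | succ n ih =>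
    obtain ⟨z, N, rfl⟩ := Multiset.card_pos_iff_exists_mem.1 (by omega : 0 < M.card) |>.imp
      fun z hz => Multiset.exists_cons_of_mem hz
    have hN : N.card = n := by simpa using h
    rw [leg_cons_smul, map_sub, map_sub, evalNovikov_mul, ih N _ hN, ih N _ hN,
      evalNovikov_mul, map_multiset_sum, Multiset.map_map]
    have hsum : (N.map fun y => evalNovikov K X
        ((leg K t ((z ::ₘ N).erase y) • a) * y)) = N.map fun y =>
        (((N.erase y).map (evalNovikov K X)).prod * ComDer.d K X (evalNovikov K X y)) *
          (evalNovikov K X z * evalNovikov K X a *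
            (ComDer.d K X)^[n + 1] (evalNovikov K X t)) := by
      refine Multiset.map_congr rfl fun y hy => ?_
      rw [evalNovikov_mul, ih, Multiset.erase_cons_tail_of_mem hy,
        Multiset.map_cons, Multiset.prod_cons]
      · ring
      · rw [Multiset.card_erase_of_mem (Multiset.mem_cons_of_mem hy), Multiset.card_cons, hN,
          Nat.pred_succ]
    simp only [Function.comp_def]
    rw [hsum, Multiset.sum_map_mul_right, ← Derivation.leibniz_multiset_prod,
      Multiset.map_cons, Multiset.prod_cons, Function.iterate_succ_apply' _ (n + 1)]
    simp only [Derivation.leibniz, smul_eq_mul]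
    ring

end Evaluation

/-! ### Monomials as pairs of sorted lists -/

section Monomials

variable {X : Type*}

/-- The monomial with given plain letters and derived letters. -/
noncomputable def lettersMonomial (xs : List X) (ys : List (ℕ ×ₗ X)) : X × ℕ →₀ ℕ :=
  (xs.map fun x => Finsupp.single (x, 0) 1).sum +
    (ys.map fun y => Finsupp.single ((ofLex y).2, (ofLex y).1) 1).sum

theorem lettersMonomial_cons (x : X) (xs : List X) (ys : List (ℕ ×ₗ X)) :
    lettersMonomial (x :: xs) ys = Finsupp.single (x, 0) 1 + lettersMonomial xs ys := by
  simp [lettersMonomial, add_assoc]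

theorem lettersMonomial_append (xs xs' : List X) (ys ys' : List (ℕ ×ₗ X)) :
    lettersMonomial (xs ++ xs') (ys ++ ys') =
      lettersMonomial xs ys + lettersMonomial xs' ys' := by
  simp only [lettersMonomial, List.map_append, List.sum_append]
  abel

theorem lettersMonomial_perm {xs xs' : List X} {ys ys' : List (ℕ ×ₗ X)} (h : xs.Perm xs')
    (h' : ys.Perm ys') : lettersMonomial xs ys = lettersMonomial xs' ys' := by
  rw [lettersMonomial, lettersMonomial, (h.map _).sum_eq, (h'.map _).sum_eq]

theorem toMultiset_lettersMonomial (xs : List X) (ys : List (ℕ ×ₗ X)) :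
    Finsupp.toMultiset (lettersMonomial xs ys) = ((xs.map fun x => (x, 0)) ++
      ys.map fun y => ((ofLex y).2, (ofLex y).1) : List (X × ℕ)) := by
  have h (l : List (X × ℕ)) :
      Finsupp.toMultiset (l.map fun p => Finsupp.single p 1).sum = (l : Multiset (X × ℕ)) := by
    induction l with
    | nil => simp
    | cons p l ih => rw [List.map_cons, List.sum_cons, map_add, ih]; simp
  rw [← h, List.map_append, List.sum_append, List.map_map, List.map_map]
  rfl

theorem weight_add (m m' : X × ℕ →₀ ℕ) : weight (m + m') = weight m + weight m' :=
  Finsupp.sum_add_index' (by simp) fun _ _ _ => by push_cast; ring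

@[simp]
theorem weight_zero : weight (0 : X × ℕ →₀ ℕ) = 0 := Finsupp.sum_zero_index

@[simp]
theorem weight_single (p : X × ℕ) (k : ℕ) :
    weight (Finsupp.single p k) = k * ((p.2 : ℤ) - 1) :=
  Finsupp.sum_single_index (by simp)

theorem weight_lettersMonomial (xs : List X) (ys : List (ℕ ×ₗ X)) :
    weight (lettersMonomial xs ys) =
      (ys.map fun y => ((ofLex y).1 : ℤ) - 1).sum - xs.length := by
  induction xs with
  | nil =>
    induction ys with
    | nil => simp [lettersMonomial]
    | cons y ys ih =>
      rw [show y :: ys = [y] ++ ys from rfl, ← List.append_nil ([] : List X),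
        lettersMonomial_append, weight_add, ih]
      simp [lettersMonomial]
  | cons x xs ih =>
    rw [lettersMonomial_cons, weight_add, ih]
    simp
    ring

/-- The pairs of lists that correspond to the monomials of weight `-1`. -/
structure IsBalanced (l : ℕ) (ys : List (ℕ ×ₗ X)) : Prop where
  one_le : ∀ y ∈ ys, 1 ≤ (ofLex y).1
  length_eq : l = (ys.map fun y => (ofLex y).1 - 1).sum + 1

theorem isBalanced_iff {xs : List X} {ys : List (ℕ ×ₗ X)} (h : ∀ y ∈ ys, 1 ≤ (ofLex y).1) :
    IsBalanced xs.length ys ↔ lettersMonomial xs ys ∈ weightNegOne X := by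
  have : (ys.map fun y => ((ofLex y).1 : ℤ) - 1).sum =
      ((ys.map fun y => (ofLex y).1 - 1).sum : ℕ) := by
    rw [Nat.cast_list_sum, List.map_map]
    refine congrArg List.sum (List.map_congr_left fun y hy => ?_)
    have := h y hy
    simp only [Function.comp_apply]
    omega
  rw [weightNegOne, Set.mem_ofPred_eq, weight_lettersMonomial, this]
  exact ⟨fun h => by have := h.length_eq; omega, fun h' => ⟨h, by omega⟩⟩

variable [LinearOrder X]

theorem plainLetters_lettersMonomial {xs : List X} {ys : List (ℕ ×ₗ X)}
    (hxs : xs.Pairwise (· ≤ ·)) (h : ∀ y ∈ ys, 1 ≤ (ofLex y).1) :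
    plainLetters (lettersMonomial xs ys) = xs := by
  have h1 : ((ys.map fun y => ((ofLex y).2, (ofLex y).1)).filter fun p => p.2 = 0) = [] := by
    simp only [List.filter_eq_nil_iff, List.mem_map]
    rintro _ ⟨y, hy, rfl⟩
    have := h y hy
    simp; omega
  have h2 : ((xs.map fun x => (x, 0)).filter fun p : X × ℕ => p.2 = 0) =
      xs.map fun x => (x, 0) := by
    simp
  rw [plainLetters, toMultiset_lettersMonomial, Multiset.filter_coe, List.filter_append, h1, h2,
    List.append_nil, Multiset.map_coe, List.map_map]
  have : (Prod.fst ∘ fun x : X => (x, 0)) = id := rfl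
  rw [this, List.map_id, Multiset.coe_sort]
  exact List.mergeSort_of_pairwise (by simpa using hxs)

theorem derivedLetters_lettersMonomial {xs : List X} {ys : List (ℕ ×ₗ X)}
    (hys : ys.Pairwise (· ≥ ·)) (h : ∀ y ∈ ys, 1 ≤ (ofLex y).1) :
    derivedLetters (lettersMonomial xs ys) = ys := by
  have h1 : ((ys.map fun y => ((ofLex y).2, (ofLex y).1)).filter fun p => 1 ≤ p.2) =
      ys.map fun y => ((ofLex y).2, (ofLex y).1) := by
    simp only [List.filter_eq_self, List.mem_map]
    rintro _ ⟨y, hy, rfl⟩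
    simpa using h y hy
  have h2 : ((xs.map fun x => (x, 0)).filter fun p : X × ℕ => 1 ≤ p.2) = [] := by
    simp
  rw [derivedLetters, toMultiset_lettersMonomial, Multiset.filter_coe, List.filter_append, h1, h2,
    List.nil_append, Multiset.map_coe, List.map_map]
  have : ((fun p : X × ℕ => toLex (p.2, p.1)) ∘
    fun y : ℕ ×ₗ X => ((ofLex y).2, (ofLex y).1)) = id := rfl
  rw [this, List.map_id, Multiset.coe_sort]
  exact List.mergeSort_of_pairwise (by simpa using hys)

theorem one_le_of_mem_derivedLetters {m : X × ℕ →₀ ℕ} {y : ℕ ×ₗ X}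
    (hy : y ∈ derivedLetters m) : 1 ≤ (ofLex y).1 := by
  rw [derivedLetters, Multiset.mem_sort] at hy
  obtain ⟨p, hp, rfl⟩ := Multiset.mem_map.1 hy
  exact (Multiset.mem_filter.1 hp).2

theorem lettersMonomial_letters (m : X × ℕ →₀ ℕ) :
    lettersMonomial (plainLetters m) (derivedLetters m) = m := by
  refine (Finsupp.orderIsoMultiset (ι := X × ℕ)).injective ?_
  change Finsupp.toMultiset _ = Finsupp.toMultiset _
  rw [toMultiset_lettersMonomial, ← Multiset.coe_add, ← Multiset.map_coe, ← Multiset.map_coe,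
    plainLetters, derivedLetters, Multiset.sort_eq, Multiset.sort_eq, Multiset.map_map,
    Multiset.map_map]
  conv_rhs => rw [← Multiset.filter_add_not (fun p : X × ℕ => p.2 = 0) (Finsupp.toMultiset m)]
  congr 1
  · conv_rhs => rw [← Multiset.map_id (Multiset.filter _ _)]
    refine Multiset.map_congr rfl fun p hp => ?_
    exact Prod.ext rfl (Multiset.mem_filter.1 hp).2.symm
  · have : (fun p : X × ℕ => 1 ≤ p.2) = fun p => ¬ p.2 = 0 := by
      ext p; exact Nat.one_le_iff_ne_zero
    simp only [this]
    exact Multiset.map_id _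

theorem isBalanced_letters {m : X × ℕ →₀ ℕ} (hm : m ∈ weightNegOne X) :
    IsBalanced (plainLetters m).length (derivedLetters m) :=
  (isBalanced_iff fun _ => one_le_of_mem_derivedLetters).2 (by rwa [lettersMonomial_letters])

theorem pairwise_plainLetters (m : X × ℕ →₀ ℕ) : (plainLetters m).Pairwise (· ≤ ·) :=
  Multiset.pairwise_sort _ _

theorem pairwise_derivedLetters (m : X × ℕ →₀ ℕ) : (derivedLetters m).Pairwise (· ≥ ·) :=
  Multiset.pairwise_sort _ _

end Monomials

/-! ### A monomial basis of the free Novikov algebra -/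

section SpiderBasis

open scoped IsMulCommutative

variable {K X : Type*} [Field K]

variable (K) in
/-- The element of the free Novikov algebra corresponding to a monomial of weight `-1`. -/
noncomputable def novSpider (xs : List X) (ys : List (ℕ ×ₗ X)) : FreeNovikov K X :=
  spider K (xs.map (novLetter K)) (ys.map fun y => ((ofLex y).1, novLetter K (ofLex y).2))

theorem iterate_d_X (t : X) (r : ℕ) :
    (ComDer.d K X)^[r] (MvPolynomial.X (t, 0)) = MvPolynomial.X (t, r) := by
  induction r with
  | zero => rfl
  | succ r ih => rw [Function.iterate_succ_apply', ih, ComDer.d, MvPolynomial.mkDerivation_X]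

theorem prod_X_eq (xs : List X) :
    (xs.map fun x => (MvPolynomial.X (x, 0) : ComDer K X)).prod =
      MvPolynomial.monomial (lettersMonomial xs []) 1 := by
  induction xs with
  | nil => simp [lettersMonomial]
  | cons x xs ih =>
    rw [lettersMonomial_cons, List.map_cons, List.prod_cons, ih, MvPolynomial.X,
      MvPolynomial.monomial_mul, one_mul]

theorem evalNovikov_novSpider {xs : List X} {ys : List (ℕ ×ₗ X)} (h : IsBalanced xs.length ys) :
    evalNovikov K X (novSpider K xs ys) = MvPolynomial.monomial (lettersMonomial xs ys) 1 := by
  induction ys generalizing xs with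
  | nil =>
    obtain ⟨x, rfl⟩ := List.length_eq_one_iff.1 (by simpa using h.length_eq)
    simp [novSpider, spider, evalNovikov_novLetter, lettersMonomial, MvPolynomial.X]
  | cons y ys ih =>
    have hlen := h.length_eq
    have hy := h.one_le y (by simp)
    rw [List.map_cons, List.sum_cons] at hlen
    obtain ⟨b, bs, rfl⟩ := List.exists_cons_of_length_eq_add_one
      (by omega : xs.length = xs.length - 1 + 1)
    obtain ⟨k, hk⟩ : ∃ k, (ofLex y).1 = k + 1 := ⟨_, (Nat.sub_add_cancel hy).symm⟩
    rw [List.length_cons, hk, Nat.add_sub_cancel] at hlen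
    have ih := @ih (b :: bs.drop k) ⟨fun z hz => h.one_le z (by simp [hz]), by simp; omega⟩
    have hp : (b :: bs).Perm ((b :: bs.drop k) ++ bs.take k) := by
      rw [List.cons_append]
      exact List.Perm.cons b ((List.perm_append_comm).trans
        (by rw [List.take_append_drop])).symm
    have hp' : (y :: ys).Perm (ys ++ [y]) := by
      simpa using List.perm_append_comm (l₁ := [y]) (l₂ := ys)
    rw [lettersMonomial_perm hp hp', lettersMonomial_append, ← one_mul (1 : K),
      ← MvPolynomial.monomial_mul, ← ih, novSpider, List.map_cons, List.map_cons, spider,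
      evalNovikov_leg_smul, novSpider, List.map_cons, hk, Nat.add_sub_cancel, ← List.map_drop,
      ← List.map_take, Multiset.map_coe, List.map_map, Multiset.prod_coe, Multiset.coe_card,
      List.length_map, List.length_take, min_eq_left (by omega), evalNovikov_novLetter,
      iterate_d_X]
    congr 1
    rw [← List.append_nil (List.take k bs), ← List.nil_append [y], lettersMonomial_append,
      ← one_mul (1 : K), ← MvPolynomial.monomial_mul, ← prod_X_eq, List.append_nil]
    congr 1
    · simp only [Function.comp_def, evalNovikov_novLetter]
    · simp [lettersMonomial, MvPolynomial.X, hk]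

theorem linearIndependent_monomial (s : Set (X × ℕ →₀ ℕ)) :
    LinearIndependent K fun m : s => (MvPolynomial.monomial m.1 1 : ComDer K X) := by
  have := (MvPolynomial.basisMonomials (X × ℕ) K).linearIndependent.comp
    (fun m : s => m.1) Subtype.val_injective
  simpa [Function.comp_def] using this

variable [LinearOrder X]

theorem novSpider_eq_letters {xs : List X} {ys : List (ℕ ×ₗ X)} (h : IsBalanced xs.length ys)
    (hys : ys.Pairwise (· ≥ ·)) :
    ∃ m ∈ weightNegOne X, novSpider K xs ys = novSpider K (plainLetters m) (derivedLetters m) := by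
  set zs := xs.insertionSort (· ≤ ·) with hzs
  have hp : zs.Perm xs := List.perm_insertionSort _ xs
  refine ⟨lettersMonomial zs ys, (isBalanced_iff h.one_le).1 (by rwa [hp.length_eq]), ?_⟩
  rw [plainLetters_lettersMonomial (List.pairwise_insertionSort _ _) h.one_le,
    derivedLetters_lettersMonomial hys h.one_le]
  exact spider_perm (hp.symm.map _) _

theorem prod_leg_smul_eq_novSpider (x : X) (L : List (X × Multiset X)) :
    ∃ (xs : List X) (ys : List (ℕ ×ₗ X)), IsBalanced xs.length ys ∧ ys.Pairwise (· ≥ ·) ∧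
      (L.map fun q => leg K (novLetter K q.1) (q.2.map (novLetter K))).prod • novLetter K x =
        novSpider K xs ys := by
  let key : X × Multiset X → ℕ ×ₗ X := fun q => toLex (q.2.card + 1, q.1)
  let r : X × Multiset X → X × Multiset X → Prop := fun p q => key q ≤ key p
  have : Std.Total r := ⟨fun p q => le_total (key q) (key p)⟩
  have : IsTrans _ r := ⟨fun _ _ _ h h' => le_trans h' h⟩
  classical
  set L' := L.insertionSort r with hL'
  have hp : L'.Perm L := List.perm_insertionSort r L
  refine ⟨x :: L'.flatMap fun q => q.2.toList, L'.map key, ⟨?_, ?_⟩, ?_, ?_⟩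
  · simp only [List.mem_map]
    rintro _ ⟨q, _, rfl⟩
    exact Nat.le_add_left 1 _
  · simp only [List.length_cons, List.length_flatMap, List.map_map]
    congr 3
    ext q
    simp [key]
  · exact List.pairwise_map.2 (List.pairwise_insertionSort r L)
  · rw [← (hp.map _).prod_eq, prod_leg_smul, novSpider, List.map_cons, List.map_flatMap,
      List.map_map]
    rfl

theorem span_novSpider :
    Submodule.span K (Set.range fun m : weightNegOne X =>
      novSpider K (plainLetters m.1) (derivedLetters m.1)) = ⊤ := by
  rw [← top_le_iff, ← FreeNovikov.eq_top_of_mul_mem (letter_mem_legSpan (novLetter K))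
    fun a ha b hb => mul_mem_legSpan _ ha hb]
  refine (legSpan_le _).trans (Submodule.span_mono ?_)
  rintro _ ⟨⟨x, L⟩, rfl⟩
  obtain ⟨xs, ys, h, hys, heq⟩ := prod_leg_smul_eq_novSpider (K := K) x L
  obtain ⟨m, hm, hm'⟩ := novSpider_eq_letters (K := K) h hys
  exact ⟨⟨m, hm⟩, (heq.trans hm').symm⟩

theorem evalNovikov_novSpider_letters (m : weightNegOne X) :
    evalNovikov K X (novSpider K (plainLetters m.1) (derivedLetters m.1)) =
      MvPolynomial.monomial m.1 1 := by
  rw [evalNovikov_novSpider (isBalanced_letters m.2), lettersMonomial_letters]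

variable (K X) in
/-- The basis of the free Novikov algebra corresponding to the monomials of weight `-1`. -/
noncomputable def spiderBasis : Module.Basis (weightNegOne X) K (FreeNovikov K X) :=
  Module.Basis.mk
    (v := fun m : weightNegOne X => novSpider K (plainLetters m.1) (derivedLetters m.1))
    (LinearIndependent.of_comp (evalNovikov K X) <| by
      simp only [Function.comp_def, evalNovikov_novSpider_letters]
      exact linearIndependent_monomial _)
    span_novSpider.ge

theorem evalNovikov_spiderBasis (m : weightNegOne X) :
    evalNovikov K X (spiderBasis K X m) = MvPolynomial.monomial m.1 1 := by
  rw [spiderBasis, Module.Basis.mk_apply, evalNovikov_novSpider_letters]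

theorem evalNovikov_injective : Function.Injective (evalNovikov K X) := by
  rw [← LinearMap.ker_eq_bot]
  refine LinearMap.ker_eq_bot.2 fun a b hab => ?_
  have h : evalNovikov K X = (Finsupp.linearCombination K fun m : weightNegOne X =>
      (MvPolynomial.monomial m.1 1 : ComDer K X)) ∘ₗ (spiderBasis K X).repr := by
    refine (spiderBasis K X).ext fun m => ?_
    simp [evalNovikov_spiderBasis]
  rw [h] at hab
  exact (spiderBasis K X).repr.injective (linearIndependent_monomial _ hab)

end SpiderBasis

/-! ### Leading monomials -/

section LeadingMonomials

/-- The sum of the squares of the orders of the letters of a monomial. -/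
def sqOrder {X : Type*} (m : X × ℕ →₀ ℕ) : ℕ := m.sum fun p k => k * p.2 ^ 2

variable {X : Type*}

theorem sqOrder_add (m m' : X × ℕ →₀ ℕ) : sqOrder (m + m') = sqOrder m + sqOrder m' :=
  Finsupp.sum_add_index' (by simp) fun _ _ _ => by ring

@[simp]
theorem sqOrder_zero : sqOrder (0 : X × ℕ →₀ ℕ) = 0 := Finsupp.sum_zero_index

@[simp]
theorem sqOrder_single (p : X × ℕ) (k : ℕ) : sqOrder (Finsupp.single p k) = k * p.2 ^ 2 :=
  Finsupp.sum_single_index (by simp)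

theorem sub_single_add_single {m : X × ℕ →₀ ℕ} {p : X × ℕ} (hp : p ∈ m.support) :
    m - Finsupp.single p 1 + Finsupp.single p 1 = m :=
  tsub_add_cancel_of_le (Finsupp.single_le_iff.2 (Nat.one_le_iff_ne_zero.2
    (Finsupp.mem_support_iff.1 hp)))

theorem sqOrder_sub_single {m : X × ℕ →₀ ℕ} {p : X × ℕ} (hp : p ∈ m.support) :
    sqOrder (m - Finsupp.single p 1) + p.2 ^ 2 = sqOrder m := by
  conv_rhs => rw [← sub_single_add_single hp, sqOrder_add, sqOrder_single, one_mul]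

theorem sqOrder_lettersMonomial_nil (zs : List X) : sqOrder (lettersMonomial zs []) = 0 := by
  induction zs with
  | nil => simp [lettersMonomial]
  | cons z zs ih => simp [lettersMonomial_cons, sqOrder_add, ih]

theorem lettersMonomial_singleton (zs : List X) (y : ℕ ×ₗ X) :
    lettersMonomial zs [y] = lettersMonomial zs [] +
      Finsupp.single ((ofLex y).2, (ofLex y).1) 1 := by
  simp [lettersMonomial]

variable {K : Type*} [Field K]

/-- The span of the monomials of weight `w` whose square order is less than `q`. -/
noncomputable def lowerSpan (K X : Type*) [Field K] (w : ℤ) (q : ℕ) : Submodule K (ComDer K X) :=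
  MvPolynomial.restrictSupport K {m | weight m = w ∧ sqOrder m < q}

theorem mem_lowerSpan {w : ℤ} {q : ℕ} {f : ComDer K X} :
    f ∈ lowerSpan K X w q ↔ ∀ m ∈ f.support, weight m = w ∧ sqOrder m < q :=
  Iff.rfl

theorem monomial_mem_lowerSpan {w : ℤ} {q : ℕ} {m : X × ℕ →₀ ℕ} (c : K) (hw : weight m = w)
    (hq : sqOrder m < q) : MvPolynomial.monomial m c ∈ lowerSpan K X w q := by
  refine mem_lowerSpan.2 fun m' hm' => ?_
  obtain rfl := Finset.mem_singleton.1 (MvPolynomial.support_monomial_subset hm')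
  exact ⟨hw, hq⟩

theorem lowerSpan_mono {w : ℤ} {q q' : ℕ} (h : q ≤ q') : lowerSpan K X w q ≤ lowerSpan K X w q' :=
  fun _ hf m hm => ⟨(hf hm).1, (hf hm).2.trans_le h⟩

theorem mul_mem_lowerSpan {w w' : ℤ} {q q' : ℕ} {f g : ComDer K X} (hf : f ∈ lowerSpan K X w q)
    (hg : g ∈ lowerSpan K X w' (q' + 1)) : f * g ∈ lowerSpan K X (w + w') (q + q') := by
  classical
  refine mem_lowerSpan.2 fun m hm => ?_
  obtain ⟨m₁, h₁, m₂, h₂, rfl⟩ := Finset.mem_add.1 (MvPolynomial.support_mul f g hm)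
  have h₁ := mem_lowerSpan.1 hf m₁ h₁
  have h₂ := mem_lowerSpan.1 hg m₂ h₂
  rw [weight_add, sqOrder_add]
  exact ⟨by rw [h₁.1, h₂.1], by omega⟩

theorem d_monomial_mem_lowerSpan {q : ℕ} {m : X × ℕ →₀ ℕ}
    (h : ∀ p ∈ m.support, sqOrder m + 2 * p.2 + 1 < q) (c : K) :
    ComDer.d K X (MvPolynomial.monomial m c) ∈ lowerSpan K X (weight m + 1) q := by
  rw [ComDer.d, MvPolynomial.mkDerivation_monomial]
  refine Submodule.smul_mem _ _ (Submodule.sum_mem _ fun p hp => ?_)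
  dsimp only
  rw [smul_eq_mul, MvPolynomial.X, MvPolynomial.monomial_mul]
  have := h p hp
  refine monomial_mem_lowerSpan _ ?_ ?_
  · conv_rhs => rw [← sub_single_add_single hp]
    simp only [weight_add, weight_single]
    push_cast
    ring
  · rw [sqOrder_add, sqOrder_single]
    have := sqOrder_sub_single hp
    dsimp only
    linarith

theorem d_mem_lowerSpan {w : ℤ} {k : ℕ} {f : ComDer K X} (hf : f ∈ lowerSpan K X w (k ^ 2)) :
    ComDer.d K X f ∈ lowerSpan K X (w + 1) ((k + 1) ^ 2) := by
  rw [f.as_sum, map_sum]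
  refine Submodule.sum_mem _ fun m hm => ?_
  obtain ⟨rfl, hq⟩ := mem_lowerSpan.1 hf m hm
  refine d_monomial_mem_lowerSpan (fun p hp => ?_) _
  have h := sqOrder_sub_single hp
  have hk : p.2 < k := lt_of_pow_lt_pow_left₀ 2 k.zero_le (by omega)
  linarith

/-- `m` is the leading monomial of `f`, with coefficient `1`: the other monomials of `f` have the
same weight and smaller square order. -/
def HasLead (f : ComDer K X) (m : X × ℕ →₀ ℕ) : Prop :=
  f - MvPolynomial.monomial m 1 ∈ lowerSpan K X (weight m) (sqOrder m)

theorem hasLead_monomial (m : X × ℕ →₀ ℕ) :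
    HasLead (MvPolynomial.monomial m 1 : ComDer K X) m := by
  rw [HasLead, sub_self]
  exact zero_mem _

theorem HasLead.mem {f : ComDer K X} {m : X × ℕ →₀ ℕ} (h : HasLead f m) :
    f ∈ lowerSpan K X (weight m) (sqOrder m + 1) := by
  rw [← sub_add_cancel f (MvPolynomial.monomial m 1)]
  exact add_mem (lowerSpan_mono (Nat.le_succ _) h)
    (monomial_mem_lowerSpan _ rfl (Nat.lt_succ_self _))

theorem HasLead.mul {f g : ComDer K X} {m m' : X × ℕ →₀ ℕ} (hf : HasLead f m)
    (hg : HasLead g m') : HasLead (f * g) (m + m') := by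
  have h : f * g - MvPolynomial.monomial (m + m') 1 =
      (f - MvPolynomial.monomial m 1) * g +
        (g - MvPolynomial.monomial m' 1) * MvPolynomial.monomial m 1 := by
    rw [← one_mul (1 : K), ← MvPolynomial.monomial_mul, one_mul]
    ring
  rw [HasLead, h, weight_add, sqOrder_add]
  refine add_mem (mul_mem_lowerSpan hf hg.mem) ?_
  rw [add_comm (weight m), add_comm (sqOrder m)]
  exact mul_mem_lowerSpan hg (hasLead_monomial m).mem

theorem HasLead.d {f : ComDer K X} {zs : List X} {t : X}
    (hf : HasLead f (lettersMonomial zs [toLex (zs.length, t)])) :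
    HasLead (ComDer.d K X f) (lettersMonomial zs [toLex (zs.length + 1, t)]) := by
  simp only [lettersMonomial_singleton, ofLex_toLex] at hf ⊢
  set k := zs.length with hk
  set m := lettersMonomial zs [] with hm
  have hm0 : sqOrder m = 0 := sqOrder_lettersMonomial_nil zs
  have hw : weight (m + Finsupp.single (t, k + 1) 1) =
      weight (m + Finsupp.single (t, k) 1) + 1 := by
    simp only [weight_add, weight_single]
    push_cast
    ring
  have hq (j : ℕ) : sqOrder (m + Finsupp.single (t, j) 1) = j ^ 2 := by
    simp [sqOrder_add, hm0]
  rw [HasLead, hq] at hf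
  have hd := d_mem_lowerSpan hf
  rw [HasLead, hq, hw]
  have h : ComDer.d K X f - MvPolynomial.monomial (m + Finsupp.single (t, k + 1) 1) 1 =
      ComDer.d K X (f - MvPolynomial.monomial (m + Finsupp.single (t, k) 1) 1) +
        MvPolynomial.monomial (Finsupp.single (t, k) 1) 1 *
          ComDer.d K X (MvPolynomial.monomial m 1) := by
    have hX : ComDer.d K X (MvPolynomial.monomial (Finsupp.single (t, k) 1) 1) =
        MvPolynomial.monomial (Finsupp.single (t, k + 1) 1) 1 := by
      change ComDer.d K X (MvPolynomial.X (t, k)) = MvPolynomial.X (t, k + 1)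
      rw [ComDer.d, MvPolynomial.mkDerivation_X]
    rw [map_sub, ← one_mul (1 : K), ← MvPolynomial.monomial_mul, ← MvPolynomial.monomial_mul,
      Derivation.leibniz, one_mul, hX, smul_eq_mul, smul_eq_mul]
    ring
  rw [h]
  refine add_mem hd ?_
  rcases Nat.eq_zero_or_pos k with hk0 | hk0
  · obtain rfl := List.length_eq_zero_iff.1 (hk.symm.trans hk0)
    have : ComDer.d K X (MvPolynomial.monomial m 1) = 0 := by
      simp [hm, lettersMonomial]
    rw [this, mul_zero]
    exact zero_mem _
  · have h1 : ComDer.d K X (MvPolynomial.monomial m 1) ∈ lowerSpan K X (weight m + 1) (1 + 1) := by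
      refine d_monomial_mem_lowerSpan (fun p hp => ?_) _
      have := sqOrder_sub_single hp
      have : p.2 = 0 := pow_eq_zero_iff two_ne_zero |>.1 (by omega)
      omega
    have h2 := mul_mem_lowerSpan (monomial_mem_lowerSpan (K := K) (X := X) (q := k ^ 2 + 1)
      (m := Finsupp.single (t, k) 1) 1 rfl (by simp)) h1
    rw [weight_add, add_comm (weight m), add_assoc]
    exact lowerSpan_mono (by nlinarith) h2

end LeadingMonomials

/-! ### Unitriangular families -/

theorem Module.Basis.linearIndependent_and_span_of_triangular {ι K V : Type*} [Field K]
    [AddCommGroup V] [Module K V] (b : Module.Basis ι K V) (q : ι → ℕ) (c : ι → V)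
    (h : ∀ i, c i - b i ∈ Submodule.span K (b '' {j | q j < q i})) :
    LinearIndependent K c ∧ ⊤ ≤ Submodule.span K (Set.range c) := by
  let F : ℕ → Submodule K V := fun n => Submodule.span K (b '' {j | q j < n})
  have hF {m n : ℕ} (hmn : m ≤ n) : F m ≤ F n :=
    Submodule.span_mono (Set.image_mono fun j hj => lt_of_lt_of_le hj hmn)
  let N : V →ₗ[K] V := b.constr K fun i => c i - b i
  have hN (n : ℕ) : ∀ v ∈ F (n + 1), N v ∈ F n := by
    intro v hv
    refine Submodule.span_le (p := (F n).comap N).2 ?_ hv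
    rintro _ ⟨i, hi, rfl⟩
    have : N (b i) = c i - b i := b.constr_basis K _ i
    change N (b i) ∈ F n
    rw [this]
    exact hF (Nat.lt_succ_iff.1 hi) (h i)
  have hc : c = fun i => ((LinearMap.id : V →ₗ[K] V) + N) (b i) := by
    ext i
    simp [N]
  have hex (v : V) : ∃ n, v ∈ F n := by
    have hv : v ∈ Submodule.span K (Set.range b) := b.span_eq ▸ Submodule.mem_top
    induction hv using Submodule.span_induction with
    | mem _ h =>
      obtain ⟨i, rfl⟩ := h
      exact ⟨q i + 1, Submodule.subset_span ⟨i, Nat.lt_succ_self _, rfl⟩⟩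
    | zero => exact ⟨0, zero_mem _⟩
    | add u v _ _ hu hv =>
      obtain ⟨m, hm⟩ := hu
      obtain ⟨n, hn⟩ := hv
      exact ⟨max m n, add_mem (hF (le_max_left _ _) hm) (hF (le_max_right _ _) hn)⟩
    | smul r v _ hv => exact hv.imp fun n hn => Submodule.smul_mem _ r hn
  constructor
  · rw [hc]
    refine b.linearIndependent.map' _ (LinearMap.ker_eq_bot'.2 fun v hv => ?_)
    have hv : v = -N v := eq_neg_of_add_eq_zero_left hv
    obtain ⟨n, hn⟩ := hex v
    induction n with
    | zero => simpa [F] using hn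
    | succ n ih => exact ih (hv ▸ neg_mem (hN n v hn))
  · have hle (n : ℕ) : F n ≤ Submodule.span K (Set.range c) := by
      induction n with
      | zero => simp [F]
      | succ n ih =>
        refine Submodule.span_le.2 ?_
        rintro _ ⟨i, hi, rfl⟩
        have := Submodule.sub_mem _ (Submodule.subset_span (Set.mem_range_self i))
          (ih (hF (Nat.lt_succ_iff.1 hi) (h i)))
        simpa using this
    intro v _
    obtain ⟨n, hn⟩ := hex v
    exact hle n hn

/-! ### Words as products of row monomials -/

section Rows

variable {X : Type*}

/-- The derived letter corresponding to a row. -/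
def FilledRow.key (ρ : FilledRow X) : ℕ ×ₗ X := toLex (ρ.len, ρ.last)

/-- The entries of the rows that are not last in their row, read from bottom to top and from left
to right. -/
def rowInits (rows : List (FilledRow X)) : List X :=
  (rows.flatMap fun ρ => ρ.init.reverse).reverse

@[simp]
theorem rowInits_nil : rowInits ([] : List (FilledRow X)) = [] := rfl

@[simp]
theorem rowInits_cons (ρ : FilledRow X) (rows : List (FilledRow X)) :
    rowInits (ρ :: rows) = rowInits rows ++ ρ.init := by
  simp [rowInits]

theorem length_rowInits (rows : List (FilledRow X)) :
    (rowInits rows).length = ((rows.map FilledRow.key).map fun y => (ofLex y).1 - 1).sum := by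
  induction rows with
  | nil => rfl
  | cons ρ rows ih => simp [ih, FilledRow.key, FilledRow.len, add_comm]

theorem isBalanced_rows (rows : List (FilledRow X)) (b : X) :
    IsBalanced (rowInits rows ++ [b]).length (rows.map FilledRow.key) where
  one_le y hy := by
    obtain ⟨ρ, -, rfl⟩ := List.mem_map.1 hy
    exact Nat.le_add_left 1 _
  length_eq := by rw [List.length_append, length_rowInits, List.length_singleton]

theorem exists_rows {xs : List X} {ys : List (ℕ ×ₗ X)} (h : IsBalanced xs.length ys) :
    ∃ b rows, xs = rowInits rows ++ [b] ∧ ys = rows.map FilledRow.key := by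
  suffices H : ∀ xs : List X, xs.length = (ys.map fun y => (ofLex y).1 - 1).sum →
      ∃ rows, xs = rowInits rows ∧ ys = rows.map FilledRow.key by
    have hl := h.length_eq
    obtain ⟨zs, b, rfl⟩ := (List.eq_nil_or_concat xs).resolve_left (by rintro rfl; simp at hl)
    rw [List.concat_eq_append] at hl ⊢
    obtain ⟨rows, rfl, rfl⟩ := H zs (by simpa using hl)
    exact ⟨b, rows, rfl, rfl⟩
  have h1 := h.one_le
  clear h
  induction ys with
  | nil => exact fun xs hxs => ⟨[], List.length_eq_zero_iff.1 (by simpa using hxs), rfl⟩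
  | cons y ys ih =>
    intro xs hxs
    have hy := h1 y (by simp)
    rw [List.map_cons, List.sum_cons] at hxs
    set s := (ys.map fun y => (ofLex y).1 - 1).sum with hs
    obtain ⟨rows, hr, rfl⟩ := ih (fun z hz => h1 z (by simp [hz])) (xs.take s) (by simp; omega)
    refine ⟨⟨xs.drop s, (ofLex y).2⟩ :: rows, ?_, ?_⟩
    · rw [rowInits_cons, ← hr, List.take_append_drop]
    · have hlen : (xs.drop s).length + 1 = (ofLex y).1 := by simp; omega
      rw [List.map_cons, FilledRow.key, FilledRow.len, hlen]
      rfl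

variable {K : Type*} [Field K]

theorem nest_append_singleton (bs : List (MagmaAlg K X)) (b c : MagmaAlg K X) :
    nest (bs ++ [b]) c = b * nest bs c := by
  simp [nest]

theorem FilledRow.monomial_append (init : List X) (b t : X) :
    (FilledRow.mk (init ++ [b]) t).monomial K =
      letter K b * (FilledRow.mk init t).monomial K := by
  simp only [monomial, List.map_append, List.map_singleton, nest_append_singleton]

theorem flatMap_append_singleton (init : List X) (b t : X) (rest : List (FilledRow X)) :
    ((⟨init ++ [b], t⟩ : FilledRow X) :: rest).flatMap (fun ρ => ρ.init.reverse) =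
      (rowInits (⟨init, t⟩ :: rest) ++ [b]).reverse := by
  simp [rowInits]

theorem phiWord_rows (rows : List (FilledRow X)) (B : MagmaAlg K X) :
    phiWord ((rowInits rows).map (letter K) ++ [B]) (rows.map FilledRow.key) =
      rows.foldl (fun u ρ => u * ρ.monomial K) B := by
  induction rows generalizing B with
  | nil => rfl
  | cons ρ rows ih =>
    rw [List.foldl_cons, ← ih, List.map_cons, phiWord]
    have hk : ((rowInits (ρ :: rows)).map (letter K) ++ [B]).length - (ofLex ρ.key).1 =
        ((rowInits rows).map (letter K)).length := by
      simp [FilledRow.key, FilledRow.len]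
    rw [hk, rowInits_cons, List.map_append, List.append_assoc, List.take_left, List.drop_left,
      nest_append_singleton]
    rfl

theorem evalNovikov_proj_mul (a b : MagmaAlg K X) :
    evalNovikov K X (FreeNovikov.proj K X (a * b)) =
      evalNovikov K X (FreeNovikov.proj K X a) *
        ComDer.d K X (evalNovikov K X (FreeNovikov.proj K X b)) := by
  rw [FreeNovikov.proj_mul, evalNovikov_mul]

theorem hasLead_letter (x : X) :
    HasLead (evalNovikov K X (FreeNovikov.proj K X (letter K x))) (Finsupp.single (x, 0) 1) := by
  have : evalNovikov K X (FreeNovikov.proj K X (letter K x)) =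
    MvPolynomial.monomial (Finsupp.single (x, 0) 1) 1 := evalNovikov_novLetter X x
  rw [this]
  exact hasLead_monomial _

theorem hasLead_nest (zs : List X) (t : X) :
    HasLead (evalNovikov K X (FreeNovikov.proj K X (nest (zs.map (letter K)) (letter K t))))
      (lettersMonomial zs [toLex (zs.length, t)]) := by
  induction zs using List.reverseRecOn with
  | nil => simpa [lettersMonomial, nest] using hasLead_letter t
  | append_singleton zs z ih =>
    rw [List.map_append, List.map_singleton, nest_append_singleton, evalNovikov_proj_mul,
      lettersMonomial_perm (List.perm_append_comm (l₁ := zs)) (List.Perm.refl _),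
      List.singleton_append, lettersMonomial_cons, List.length_append, List.length_singleton]
    exact (hasLead_letter z).mul ih.d

theorem hasLead_foldl_rows (rows : List (FilledRow X)) {B : MagmaAlg K X} {m : X × ℕ →₀ ℕ}
    (hB : HasLead (evalNovikov K X (FreeNovikov.proj K X B)) m) :
    HasLead (evalNovikov K X (FreeNovikov.proj K X
        (rows.foldl (fun u ρ => u * ρ.monomial K) B)))
      (m + lettersMonomial (rowInits rows) (rows.map FilledRow.key)) := by
  induction rows generalizing B m with
  | nil => simpa [lettersMonomial] using hB
  | cons ρ rows ih =>
    have h : HasLead (evalNovikov K X (FreeNovikov.proj K X (B * ρ.monomial K)))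
        (m + lettersMonomial ρ.init [ρ.key]) := by
      rw [evalNovikov_proj_mul]
      exact hB.mul (hasLead_nest ρ.init ρ.last).d
    have := ih h
    rw [add_assoc, ← lettersMonomial_append, lettersMonomial_perm List.perm_append_comm
      (List.Perm.refl _)] at this
    rwa [List.foldl_cons, rowInits_cons, List.map_cons, ← List.singleton_append]

end Rows

/-! ### The basis `N_φ` -/

section Basis

variable {K X : Type*} [Field K] [LinearOrder X]

variable (K) in
/-- The value of `φ` on a monomial. -/
noncomputable def phiMonomial (m : X × ℕ →₀ ℕ) : MagmaAlg K X :=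
  phiWord ((plainLetters m).map (letter K)) (derivedLetters m)

theorem exists_rows_of_mem {m : X × ℕ →₀ ℕ} (hm : m ∈ weightNegOne X) :
    ∃ b rows, plainLetters m = rowInits rows ++ [b] ∧
      derivedLetters m = rows.map FilledRow.key :=
  exists_rows (isBalanced_letters hm)

theorem phiMonomial_eq_foldl {m : X × ℕ →₀ ℕ} {b : X} {rows : List (FilledRow X)}
    (h : plainLetters m = rowInits rows ++ [b])
    (h' : derivedLetters m = rows.map FilledRow.key) :
    phiMonomial K m = rows.foldl (fun u ρ => u * ρ.monomial K) (letter K b) := by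
  rw [phiMonomial, h, h', List.map_append, List.map_singleton, phiWord_rows]

theorem hasLead_phiMonomial {m : X × ℕ →₀ ℕ} (hm : m ∈ weightNegOne X) :
    HasLead (evalNovikov K X (FreeNovikov.proj K X (phiMonomial K m))) m := by
  obtain ⟨b, rows, h, h'⟩ := exists_rows_of_mem hm
  have := hasLead_foldl_rows rows (hasLead_letter (K := K) b)
  rwa [← phiMonomial_eq_foldl h h', ← lettersMonomial_cons,
    lettersMonomial_perm (xs := b :: rowInits rows) (xs' := rowInits rows ++ [b])
      (List.perm_append_singleton _ _).symm (List.Perm.refl _), ← h, ← h',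
    lettersMonomial_letters] at this

theorem phiMonomial_triangular (m : weightNegOne X) :
    FreeNovikov.proj K X (phiMonomial K m.1) - spiderBasis K X m ∈
      Submodule.span K (spiderBasis K X '' {m' | sqOrder m'.1 < sqOrder m.1}) := by
  have h := hasLead_phiMonomial (K := K) m.2
  rw [HasLead, lowerSpan, MvPolynomial.restrictSupport_eq_span,
    ← evalNovikov_spiderBasis (K := K) m, ← map_sub] at h
  have hmap : (fun n => MvPolynomial.monomial n (1 : K)) ''
      {n : X × ℕ →₀ ℕ | weight n = weight m.1 ∧ sqOrder n < sqOrder m.1} ⊆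
      evalNovikov K X '' (spiderBasis K X '' {m' | sqOrder m'.1 < sqOrder m.1}) := by
    rintro _ ⟨n, ⟨hw, hn⟩, rfl⟩
    exact ⟨_, ⟨⟨n, hw.trans m.2⟩, hn, rfl⟩, evalNovikov_spiderBasis _⟩
  have h := Submodule.span_mono hmap h
  rw [Submodule.span_image] at h
  obtain ⟨v, hv, hv'⟩ := h
  rwa [← evalNovikov_injective hv']

theorem proj_phiMonomial_basis :
    (LinearIndependent K fun m : weightNegOne X => FreeNovikov.proj K X (phiMonomial K m.1)) ∧
      ⊤ ≤ Submodule.span K (Set.range fun m : weightNegOne X =>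
        FreeNovikov.proj K X (phiMonomial K m.1)) :=
  (spiderBasis K X).linearIndependent_and_span_of_triangular (fun m => sqOrder m.1) _
    phiMonomial_triangular

theorem phi_monomial (a : ComDerNegOne K X) (m : weightNegOne X)
    (ha : (a : ComDer K X) = MvPolynomial.monomial m.1 1) : phi K X a = phiMonomial K m.1 := by
  have : a = MvPolynomial.basisRestrictSupport K (weightNegOne X) m := by
    refine (MvPolynomial.basisRestrictSupport K (weightNegOne X)).repr.injective ?_
    rw [Module.Basis.repr_self]
    ext n
    change MvPolynomial.coeff n.1 (a : ComDer K X) = _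
    rw [ha, MvPolynomial.coeff_monomial, Finsupp.single_apply]
    simp only [Subtype.ext_iff]
  rw [this, phi, Module.Basis.constr_basis, phiMonomial]

theorem Nphi_eq_range : Nphi K X = Set.range fun m : weightNegOne X => phiMonomial K m.1 := by
  ext w
  constructor
  · rintro ⟨a, ⟨m, hm, ha⟩, rfl⟩
    exact ⟨⟨m, hm⟩, (phi_monomial a ⟨m, hm⟩ ha).symm⟩
  · rintro ⟨m, rfl⟩
    exact ⟨⟨MvPolynomial.monomial m.1 1,
      (MvPolynomial.monomial_mem_restrictSupport K).2 (Or.inl m.2)⟩, ⟨m.1, m.2, rfl⟩,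
      phi_monomial _ m rfl⟩

theorem exists_basis_Nphi : ∃ b : Module.Basis (Nphi K X) K (FreeNovikov K X),
    ∀ w : Nphi K X, b w = FreeNovikov.proj K X w := by
  obtain ⟨hli, hspan⟩ := proj_phiMonomial_basis (K := K) (X := X)
  have hinj : Function.Injective fun m : weightNegOne X => phiMonomial K m.1 :=
    fun m m' h => hli.injective (congrArg (FreeNovikov.proj K X) h)
  let e : weightNegOne X ≃ Nphi K X :=
    (Equiv.ofInjective _ hinj).trans (Equiv.setCongr Nphi_eq_range.symm)
  refine ⟨(Module.Basis.mk hli hspan).reindex e, fun w => ?_⟩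
  obtain ⟨m, rfl⟩ := e.surjective w
  rw [Module.Basis.reindex_apply, Equiv.symm_apply_apply, Module.Basis.mk_apply]
  rfl

end Basis

/-! ### Filled Young diagrams -/

section Young

variable {K X : Type*} [Field K] [LinearOrder X]

theorem FilledRow.key_le_key {ρ σ : FilledRow X} :
    σ.key ≤ ρ.key ↔ σ.len ≤ ρ.len ∧ (ρ.len = σ.len → σ.last ≤ ρ.last) := by
  rw [key, key, Prod.Lex.toLex_le_toLex]
  constructor
  · rintro (h | ⟨h, h'⟩)
    · exact ⟨h.le, fun he => absurd he h.ne'⟩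
    · exact ⟨h.le, fun _ => h'⟩
  · rintro ⟨h, h'⟩
    exact h.lt_or_eq.imp_right fun he => ⟨he, h' he.symm⟩

theorem phiMonomial_mem_range {m : X × ℕ →₀ ℕ} (hm : m ∈ weightNegOne X) :
    phiMonomial K m ∈ Set.range (FilledYoung.monomial K : FilledYoung X → MagmaAlg K X) := by
  obtain ⟨b, rows, h, h'⟩ := exists_rows_of_mem hm
  rw [phiMonomial_eq_foldl h h']
  have hx := pairwise_plainLetters m
  have hy := pairwise_derivedLetters m
  rw [h] at hx
  rw [h'] at hy
  cases rows with
  | nil =>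
    exact ⟨⟨⟨[], b⟩, [], by simp, by simp, by simp, by simp, by simp⟩, rfl⟩
  | cons ρ rest =>
    rw [List.pairwise_map, List.pairwise_cons] at hy
    simp only [ge_iff_le, FilledRow.key_le_key] at hy
    obtain ⟨hy1, hy2⟩ := hy
    obtain ⟨init, t⟩ := ρ
    refine ⟨⟨⟨init ++ [b], t⟩, rest, fun ρ hρ => ?_, hy2.imp fun h => h.1, ?_, fun ρ hρ hl => ?_,
      (hy2.imp fun h => h.2).isChain⟩, ?_⟩
    · have := (hy1 ρ hρ).1
      simp only [FilledRow.len, List.length_append, List.length_singleton] at this ⊢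
      omega
    · rw [flatMap_append_singleton, List.pairwise_reverse]
      exact hx
    · refine (hy1 ρ (List.mem_of_mem_head? hρ)).2 ?_
      simp only [FilledRow.len, List.length_append, List.length_singleton] at hl ⊢
      omega
    · rw [FilledYoung.monomial, List.foldl_cons, FilledRow.monomial_append]

theorem exists_phiMonomial_eq {b : X} {rows : List (FilledRow X)}
    (hx : (rowInits rows ++ [b]).Pairwise (· ≤ ·))
    (hy : (rows.map FilledRow.key).Pairwise (· ≥ ·)) :
    ∃ m ∈ weightNegOne X,
      phiMonomial K m = rows.foldl (fun u ρ => u * ρ.monomial K) (letter K b) := by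
  have hb := isBalanced_rows rows b
  exact ⟨_, (isBalanced_iff hb.one_le).1 hb,
    phiMonomial_eq_foldl (plainLetters_lettersMonomial hx hb.one_le)
      (derivedLetters_lettersMonomial hy hb.one_le)⟩

theorem FilledYoung.exists_phiMonomial_eq_monomial (T : FilledYoung X) :
    ∃ m ∈ weightNegOne X, phiMonomial K m = T.monomial K := by
  obtain ⟨⟨init, t⟩, rest, hlong, hlen, hinit, hfirst, hlast⟩ := T
  rcases List.eq_nil_or_concat init with rfl | ⟨inits, b, hb⟩
  · obtain rfl : rest = [] := List.eq_nil_iff_forall_not_mem.2 fun ρ hρ => by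
      have := hlong ρ hρ
      simp [FilledRow.len] at this
    exact exists_phiMonomial_eq (b := t) (rows := []) (by simp) (by simp)
  · rw [List.concat_eq_append] at hb
    subst hb
    rw [FilledYoung.monomial, FilledRow.monomial_append]
    refine exists_phiMonomial_eq (b := b) (rows := ⟨inits, t⟩ :: rest) ?_ ?_
    · rw [flatMap_append_singleton, List.pairwise_reverse] at hinit
      exact hinit
    · rw [← List.isChain_iff_pairwise, List.isChain_map, List.isChain_cons]
      simp only [ge_iff_le, FilledRow.key_le_key]
      refine ⟨fun ρ hρ => ⟨?_, fun h => hfirst ρ hρ ?_⟩, ?_⟩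
      · have := hlong ρ (List.mem_of_mem_head? hρ)
        simp only [FilledRow.len, List.length_append, List.length_singleton] at this ⊢
        omega
      · simp only [FilledRow.len, List.length_append, List.length_singleton] at h ⊢
        omega
      · rw [List.isChain_iff_getElem] at hlast ⊢
        exact fun i hi => ⟨List.pairwise_iff_getElem.1 hlen _ _ _ hi (Nat.lt_succ_self i),
          hlast i hi⟩

end Young

theorem theorem2 (K : Type*) [Field K] [CharZero K] (X : Type*) [LinearOrder X]
    [WellFoundedLT X] :
    (∃ b : Module.Basis (Nphi K X) K (FreeNovikov K X),
      ∀ w : Nphi K X, b w = FreeNovikov.proj K X w) ∧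
    Nphi K X = Set.range (FilledYoung.monomial K : FilledYoung X → MagmaAlg K X) := by
  refine ⟨exists_basis_Nphi, ?_⟩
  rw [Nphi_eq_range]
  refine Set.Subset.antisymm ?_ ?_
  · rintro _ ⟨m, rfl⟩
    exact phiMonomial_mem_range m.2
  · rintro _ ⟨T, rfl⟩
    obtain ⟨m, hm, h⟩ := T.exists_phiMonomial_eq_monomial (K := K)
    exact ⟨⟨m, hm⟩, h⟩
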